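/- All graphs are finite and simple. A maximal matching of a graph $G$ is a matching that is not properly contained in another matching of $G$, and the saturation number $s(G)$ is the number of edges of a smallest maximal matching of $G$. Let $P$ be a plane graph whose outer face is bounded by a cycle, whose boundary vertices have degree 2 or 3, whose inner vertices have degree 3, and in which no boundary edge joins two vertices of degree 3. To surround $P$ with a layer of hexagons, join every boundary vertex of degree 2 to a new vertex placed outside $P$, and join the new vertices cyclically by paths so that each new bounded face, lying between two consecutive joining edges, is a hexagon; the result is again of this kind. Surrounding $P$ with $\ell$ concentric layers means doing this $\ell$ times. For $k\ge 3$ and $\ell\ge 0$ let $CNC_k(\ell)$ be the cycle on $k$ vertices surrounded with $\ell$ concentric layers of hexagons. For $\ell\ge0$ let $CN_i^j(\ell)$ be the following plane graph $CN_i^j$ (with $i$ pentagons) surrounded with $\ell$ concentric layers of hexagons. Each $CN_i^j$ consists of a boundary cycle $1,2,\dots,m$ in this cyclic order, and of the listed further edges drawn inside it: - $CN_2^s$: $m=12$; edges $13\,14$, $13\,3$, $13\,12$, $14\,6$, $14\,9$. - $CN_2^a$: $m=10$; edges $11\,4$, $11\,7$, $11\,10$. - $CN_3^s$: $m=9$;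 edges $10\,3$, $10\,6$, $10\,9$. - $CN_3^a$: $m=13$; edges $14\,15$, $15\,16$, $14\,3$, $14\,13$, $15\,6$, $16\,8$, $16\,11$. - $CN_4^s$: $m=10$; edges $11\,12$, $11\,3$, $11\,10$, $12\,5$, $12\,8$. - $CN_4^a$: $m=12$; edges $13\,15$, $14\,15$, $13\,3$, $13\,12$, $14\,5$, $14\,8$, $15\,10$. - $CN_5^a$: $m=11$; edges $12\,13$, $12\,14$, $14\,15$, $15\,16$, $13\,16$, $12\,3$, $13\,11$, $14\,5$, $15\,7$, $16\,9$. **Theorem.** For all integers $\ell\ge 0$ and $k\ge 3$: (a) $s(CNC_k(\ell)) \le k \left\lfloor \frac{\ell(\ell+2)}{3} \right\rfloor + k(\ell+1)$; (b) $s(CN_2^s(\ell)) \le 4 \left\lfloor \frac{(\ell+1)(\ell+3)}{3} \right\rfloor + 4(\ell + 1) + 1$; (c) $s(CN_2^a(\ell)) \le 3 \left\lfloor \frac{(\ell+1)(\ell+3)}{3} \right\rfloor + \left\lfloor \frac{\ell (\ell+2)}{3} \right\rfloor + 4(\ell + 1) + 1$; (d) $s(CN_3^s(\ell)) \le 3 \left\lfloor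 \frac{(\ell+1)(\ell+3)}{3} \right\rfloor + 3(\ell + 1) + 1$; (e) $s(CN_3^a(\ell)) \le 2 \left\lfloor \frac{(\ell+2)(\ell+4)}{3} \right\rfloor + \left\lfloor \frac{(\ell+1)(\ell+3)}{3} \right\rfloor + 3(\ell + 1) + 2$; (f) $s(CN_4^s(\ell)) \le 2 \left\lfloor \frac{(\ell+2)(\ell+4)}{3} \right\rfloor + 2(\ell + 1) + 3$; (g) $s(CN_4^a(\ell)) \le \left\lfloor \frac{(\ell+3)(\ell+5)}{3} \right\rfloor + \left\lfloor \frac{(\ell+2)(\ell+4)}{3} \right\rfloor + 2(\ell + 1) + 4$; (h) $s(CN_5^a(\ell)) \le \left\lfloor \frac{(\ell+5)(\ell+7)}{3} \right\rfloor + (\ell + 1) + 6$. -/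

import Mathlib

/-- The saturation number of a graph: the size of a smallest maximal matching.  It is valued in
`ℕ∞`, so that `s(G) ≤ m` holds exactly if some maximal matching has at most `m` edges. -/
noncomputable def saturationNumber {V : Type*} (G : SimpleGraph V) : ℕ∞ :=
  ⨅ (M : G.Subgraph) (_ : Maximal SimpleGraph.Subgraph.IsMatching M), M.edgeSet.encard

/-- A pseudoconvex cap (a plane patch without bend edges), encoded as follows.

* Its boundary is a cycle, cut at the break edges into `sides` consecutive paths.  The `i`-th path
  has `2 * len i + 1` vertices at positions `0, 1, …, 2 * len i`, of degrees `2, 3, 2, …, 3, 2`;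
  so `len i` is the number of vertices of degree 3 on it, that is, the length of the side.
  The last vertex of each path is joined to the first vertex of the next one by a break edge.
* There are `inner` further vertices `0, …, inner - 1`, inside the boundary cycle.
* `(u, v) ∈ innerEdges` is an edge between the inner vertices `u` and `v`.
* `(u, i, p) ∈ spokes` is an edge between the inner vertex `u` and the boundary vertex at
  position `p` (odd) of the path `i`. -/
structure ConeCap where
  sides : ℕ
  len : Fin sides → ℕ
  inner : ℕ
  innerEdges : List (ℕ × ℕ)
  spokes : List (ℕ × ℕ × ℕ)

namespace ConeCap

/-- The vertices of the cap surrounded by `ℓ` layers of hexagons: the inner vertices of the cap,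
and the vertices `⟨(t, i), p⟩` at position `p` of the `i`-th path of the `t`-th concentric cycle.
The cycle `t = 0` is the boundary of the cap, the cycle `t` is the boundary after `t` layers. -/
abbrev Vertex (C : ConeCap) (ℓ : ℕ) : Type :=
  Fin C.inner ⊕ (x : Fin (ℓ + 1) × Fin C.sides) × Fin (2 * (C.len x.2 + x.1) + 1)

/-- The edges of the cap surrounded by `ℓ` layers of hexagons, each in one direction.

To add a layer to a patch whose boundary consists of paths `2, 3, 2, …, 3, 2`, each boundary vertex
of degree 2 (even position `p`) sends an edge outwards.  Two consecutive such edges and the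
boundary between them (`2, 3, 2` inside a path, or a break edge `2, 2`) must lie on a hexagon, so
that between their outer ends there is exactly one new vertex in the first case, and there are
exactly two, joined by a new break edge, in the second.  Hence the new boundary again consists of
`sides` paths of that kind, each longer by two vertices, and the edge sent outwards from
position `p` ends at position `p + 1` of the same path. -/
def Link (C : ConeCap) (ℓ : ℕ) : C.Vertex ℓ → C.Vertex ℓ → Prop
  -- edges inside the cap
  | .inl u, .inl v => (u.val, v.val) ∈ C.innerEdges
  | .inl u, .inr ⟨(t, i), p⟩ => t.val = 0 ∧ (u.val, i.val, p.val) ∈ C.spokes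
  | .inr _, .inl _ => False
  | .inr ⟨(t, i), p⟩, .inr ⟨(t', i'), p'⟩ =>
      -- consecutive vertices of a path
      (t = t' ∧ i = i' ∧ p.val + 1 = p'.val) ∨
      -- break edge from the end of a path to the start of the next one, in cyclic order
      (t = t' ∧ (i.val + 1) % C.sides = i'.val ∧ p.val = 2 * (C.len i + t) ∧ p'.val = 0) ∨
      -- edge between two successive concentric cycles
      (t.val + 1 = t'.val ∧ i = i' ∧ Even p.val ∧ p'.val = p.val + 1)

/-- The cap surrounded by `ℓ` concentric layers of hexagons. -/
def cone (C : ConeCap) (ℓ : ℕ) : SimpleGraph (C.Vertex ℓ) :=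
  SimpleGraph.fromRel (C.Link ℓ)

end ConeCap

/-- The cycle on `k` vertices: all vertices have degree 2 and all edges are break edges. -/
abbrev capCycle (k : ℕ) : ConeCap where
  sides := k
  len := fun _ => 0
  inner := 0
  innerEdges := []
  spokes := []

/-- Two pentagons and two hexagons, symmetric (14 vertices). -/
abbrev capTwoSym : ConeCap where
  sides := 4
  len := ![1, 1, 1, 1]
  inner := 2
  innerEdges := [(0, 1)]
  spokes := [(0, 0, 1), (0, 3, 1), (1, 1, 1), (1, 2, 1)]

/-- Two pentagons and one hexagon, asymmetric (11 vertices). -/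
abbrev capTwoAsym : ConeCap where
  sides := 4
  len := ![0, 1, 1, 1]
  inner := 1
  innerEdges := []
  spokes := [(0, 1, 1), (0, 2, 1), (0, 3, 1)]

/-- Three pentagons around a vertex, symmetric (10 vertices). -/
abbrev capThreeSym : ConeCap where
  sides := 3
  len := ![1, 1, 1]
  inner := 1
  innerEdges := []
  spokes := [(0, 0, 1), (0, 1, 1), (0, 2, 1)]

/-- Three pentagons and two hexagons, asymmetric (16 vertices). -/
abbrev capThreeAsym : ConeCap where
  sides := 3
  len := ![1, 2, 2]
  inner := 3
  innerEdges := [(0, 1), (1, 2)]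
  spokes := [(0, 0, 1), (0, 2, 3), (1, 1, 1), (2, 1, 3), (2, 2, 1)]

/-- Four pentagons, symmetric (12 vertices). -/
abbrev capFourSym : ConeCap where
  sides := 2
  len := ![2, 2]
  inner := 2
  innerEdges := [(0, 1)]
  spokes := [(0, 0, 1), (0, 1, 3), (1, 0, 3), (1, 1, 1)]

/-- Four pentagons and one hexagon, asymmetric (15 vertices). -/
abbrev capFourAsym : ConeCap where
  sides := 2
  len := ![2, 3]
  inner := 3
  innerEdges := [(0, 2), (1, 2)]
  spokes := [(0, 0, 1), (0, 1, 5), (1, 0, 3), (1, 1, 1), (2, 1, 3)]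

/-- Five pentagons and one hexagon, asymmetric (16 vertices). -/
abbrev capFiveAsym : ConeCap where
  sides := 1
  len := ![5]
  inner := 5
  innerEdges := [(0, 1), (0, 2), (1, 4), (2, 3), (3, 4)]
  spokes := [(0, 0, 1), (1, 0, 9), (2, 0, 3), (3, 0, 5), (4, 0, 7)]

/-- The single-defect `k`-gonal nanocone with `ℓ` layers. -/
abbrev CNC (k ℓ : ℕ) := (capCycle k).cone ℓ

/-- The pentagonal defect nanocones with `ℓ` layers: the digit is the number of pentagons, and
`s` / `a` stand for the symmetric / asymmetric cap. -/
abbrev CN2s (ℓ : ℕ) := capTwoSym.cone ℓ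

abbrev CN2a (ℓ : ℕ) := capTwoAsym.cone ℓ

abbrev CN3s (ℓ : ℕ) := capThreeSym.cone ℓ

abbrev CN3a (ℓ : ℕ) := capThreeAsym.cone ℓ

abbrev CN4s (ℓ : ℕ) := capFourSym.cone ℓ

abbrev CN4a (ℓ : ℕ) := capFourAsym.cone ℓ

abbrev CN5a (ℓ : ℕ) := capFiveAsym.cone ℓ

/-!
The bounds hold because every cone has a vertex cover that splits into few cells, each of which is
a single vertex or a pair of adjacent vertices.

If the vertex cover consists of `m` such cells, then `s(G) ≤ m`: the two-element cells form a
matching, which extends to a maximal matching `M`.  Every edge of `M` has an end in the cover, and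
two edges of `M` cannot reach the same cell, as they would share a vertex or both be the
edge spanned by that cell (`saturationNumber_le_card_cells`).

In a cone, cover all inner vertices of the cap (each a cell of its own) and, on each of the
paths into which the concentric cycles are cut, the positions `p` with `p % 3 ≠ 2`; the cells are
`{3j, 3j + 1}`, or `{3j}` at the end of a path.  The positions left out are independent: two
consecutive integers are not both `2` modulo `3`, which takes care of the edges along a path and of
those between cycles, where the position grows by one; and a break edge ends at position `0`.  So a
path with `n` vertices contributes `⌈n / 3⌉` cells (`ConeCap.saturationNumber_cone_le`).  Summing
over the layers gives at most `⌊(ℓ + a)(ℓ + a + 2) / 3⌋ + (ℓ + 1)` for a side of length `a`, with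
something to spare if `a > 0` (`sum_layers_le`).
-/

/-! ### Maximal matchings from a vertex cover -/

/-- An edge of a matching is determined by either of its ends. -/
theorem SimpleGraph.Subgraph.IsMatching.edge_eq {V : Type*} {G : SimpleGraph V} {M : G.Subgraph}
    (hM : M.IsMatching) {e : Sym2 V} (he : e ∈ M.edgeSet) {u v : V} (hu : u ∈ e)
    (huv : M.Adj u v) : e = s(u, v) := by
  obtain ⟨w, rfl⟩ := Sym2.mem_iff_exists.1 hu
  rw [hM.eq_of_adj_left (SimpleGraph.Subgraph.mem_edgeSet.1 he) huv]

/-- If the vertex cover `S` is split by `c` into cells of at most two vertices, the two vertices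
of a cell being adjacent, then `s(G)` is at most the number of cells. -/
theorem saturationNumber_le_card_cells {V J : Type*} [Finite V] {G : SimpleGraph V} {S : Set V}
    (c : V → J) (hcover : ∀ u v, G.Adj u v → u ∈ S ∨ v ∈ S)
    (hadj : ∀ u ∈ S, ∀ v ∈ S, u ≠ v → c u = c v → G.Adj u v)
    (hcell : ∀ u ∈ S, ∀ v ∈ S, ∀ w ∈ S, u ≠ v → c u = c v → u ≠ w → c u = c w → v = w) :
    saturationNumber G ≤ ENat.card J := by
  let M₀ : G.Subgraph :=
    { verts := {u | ∃ v, u ∈ S ∧ v ∈ S ∧ u ≠ v ∧ c u = c v}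
      Adj := fun u v => u ∈ S ∧ v ∈ S ∧ u ≠ v ∧ c u = c v
      adj_sub := fun ⟨hu, hv, hne, h⟩ => hadj _ hu _ hv hne h
      edge_vert := fun {_ v} h => ⟨v, h⟩
      symm := ⟨fun _ _ ⟨hu, hv, hne, h⟩ => ⟨hv, hu, hne.symm, h.symm⟩⟩ }
  have hM₀ : M₀.IsMatching := by
    rintro u ⟨v, hu, hv, hne, h⟩
    exact ⟨v, ⟨hu, hv, hne, h⟩, fun w ⟨_, hw, hne', h'⟩ =>
      (hcell u hu v hv w hw hne h hne' h').symm⟩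
  obtain ⟨M, hle, hM⟩ := Finite.exists_le_maximal hM₀
  refine (iInf₂_le M hM).trans ?_
  have hend : ∀ e : M.edgeSet, ∃ v ∈ S, v ∈ e.1 := by
    rintro ⟨⟨u, v⟩, he⟩
    rcases hcover u v (M.adj_sub he) with h | h
    · exact ⟨u, h, Sym2.mem_mk_left u v⟩
    · exact ⟨v, h, Sym2.mem_mk_right u v⟩
  choose f hfS hfe using hend
  refine ENat.card_le_card_of_injective (f := fun e => c (f e)) fun e e' h => Subtype.ext ?_
  by_cases hne : f e = f e'
  · obtain ⟨w, hw⟩ := Sym2.mem_iff_exists.1 (hfe e)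
    have hadj' : M.Adj (f e) w := by
      rw [← SimpleGraph.Subgraph.mem_edgeSet, ← hw]
      exact e.2
    rw [hw, hM.prop.edge_eq e'.2 (hne ▸ hfe e') hadj']
  · have hMadj : M.Adj (f e) (f e') := hle.2 ⟨hfS e, hfS e', hne, h⟩
    rw [hM.prop.edge_eq e.2 (hfe e) hMadj, hM.prop.edge_eq e'.2 (hfe e') hMadj.symm, Sym2.eq_swap]

/-! ### The vertex cover of a cone -/

namespace ConeCap

/-- The cells of the vertex cover of a cone: one for each inner vertex of the cap, and `⌈n / 3⌉`
for each path with `n = 2 * (C.len i + t) + 1` vertices. -/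
abbrev Cell (C : ConeCap) (ℓ : ℕ) : Type :=
  Fin C.inner ⊕ (x : Fin (ℓ + 1) × Fin C.sides) × Fin ((2 * (C.len x.2 + x.1) + 3) / 3)

/-- The cell of a vertex: three consecutive positions `3j, 3j + 1, 3j + 2` of a path go to the
same cell, the last of them being outside the cover. -/
def cell (C : ConeCap) (ℓ : ℕ) : C.Vertex ℓ → C.Cell ℓ
  | .inl u => .inl u
  | .inr ⟨x, p⟩ => .inr ⟨x, p.val / 3, by have := p.2; omega⟩

/-- The vertex cover of a cone: the inner vertices of the cap, and the vertices at the positions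
that are not `2` modulo `3`. -/
def cover (C : ConeCap) (ℓ : ℕ) : Set (C.Vertex ℓ) :=
  {v | ∀ x p, v = .inr ⟨x, p⟩ → p.val % 3 ≠ 2}

theorem inr_mem_cover {C : ConeCap} {ℓ : ℕ} {x : Fin (ℓ + 1) × Fin C.sides}
    {p : Fin (2 * (C.len x.2 + x.1) + 1)} :
    (.inr ⟨x, p⟩ : C.Vertex ℓ) ∈ C.cover ℓ ↔ p.val % 3 ≠ 2 := by
  refine ⟨fun h => h x p rfl, ?_⟩
  rintro h y q hyq
  cases hyq
  exact h

theorem mem_cover_or_of_link {C : ConeCap} {ℓ : ℕ} {u v : C.Vertex ℓ} (h : C.Link ℓ u v) :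
    u ∈ C.cover ℓ ∨ v ∈ C.cover ℓ := by
  match u, v, h with
  | .inl _, _, _ => exact Or.inl nofun
  | .inr ⟨(t, i), p⟩, .inr ⟨(t', i'), p'⟩, h =>
    simp only [inr_mem_cover]
    rcases h with ⟨_, _, h⟩ | ⟨_, _, _, h⟩ | ⟨_, _, _, h⟩ <;> omega

/-- Two distinct vertices in a common cell of the cover are consecutive on a path. -/
theorem exists_of_cell_eq {C : ConeCap} {ℓ : ℕ} {u v : C.Vertex ℓ} (hu : u ∈ C.cover ℓ)
    (hv : v ∈ C.cover ℓ) (hne : u ≠ v) (h : C.cell ℓ u = C.cell ℓ v) :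
    ∃ x p q, u = .inr ⟨x, p⟩ ∧ v = .inr ⟨x, q⟩ ∧
      (p.val % 3 = 0 ∧ q.val = p.val + 1 ∨ q.val % 3 = 0 ∧ p.val = q.val + 1) := by
  match u, v with
  | .inl u, .inl v =>
    simp only [cell, Sum.inl.injEq] at h
    exact absurd (congrArg Sum.inl h) hne
  | .inr ⟨x, p⟩, .inr ⟨y, q⟩ =>
    simp only [cell, Sum.inr.injEq, Sigma.mk.injEq] at h
    obtain ⟨rfl, h⟩ := h
    rw [heq_eq_eq, Fin.mk.injEq] at h
    rw [inr_mem_cover] at hu hv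
    have hpq : p.val ≠ q.val := fun h => hne (by rw [Fin.ext h])
    exact ⟨x, p, q, rfl, rfl, by omega⟩

/-- The saturation number of a cone is at most the number of cells of its vertex cover. -/
theorem saturationNumber_cone_le (C : ConeCap) (ℓ : ℕ) :
    saturationNumber (C.cone ℓ) ≤
      ((C.inner + ∑ i, ∑ t ∈ Finset.range (ℓ + 1), (2 * (C.len i + t) + 3) / 3 : ℕ) : ℕ∞) := by
  have hcard : ENat.card (C.Cell ℓ) =
      ((C.inner + ∑ i, ∑ t ∈ Finset.range (ℓ + 1), (2 * (C.len i + t) + 3) / 3 : ℕ) : ℕ∞) := by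
    rw [ENat.card_eq_coe_fintype_card]
    simp only [Fintype.card_sum, Fintype.card_sigma, Fintype.card_fin, Fintype.sum_prod_type_right,
      Finset.sum_range]
  rw [← hcard]
  refine saturationNumber_le_card_cells (S := C.cover ℓ) (C.cell ℓ) ?_ ?_ ?_
  · rintro u v ⟨-, h | h⟩
    · exact mem_cover_or_of_link h
    · exact (mem_cover_or_of_link h).symm
  · intro u hu v hv hne h
    refine (SimpleGraph.fromRel_adj _ _ _).2 ⟨hne, ?_⟩
    obtain ⟨⟨t, i⟩, p, q, rfl, rfl, ⟨-, h⟩ | ⟨-, h⟩⟩ := exists_of_cell_eq hu hv hne h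
    · exact Or.inl (Or.inl ⟨rfl, rfl, h.symm⟩)
    · exact Or.inr (Or.inl ⟨rfl, rfl, h.symm⟩)
  · intro u hu v hv w hw huv h huw h'
    by_contra hvw
    obtain ⟨x, p, q, rfl, rfl, hpq⟩ := exists_of_cell_eq hu hv huv h
    obtain ⟨y, p', r, hp', rfl, hpr⟩ := exists_of_cell_eq hu hw huw h'
    cases hp'
    have hqr : q.val ≠ r.val := fun h => hvw (by rw [Fin.ext h])
    omega

end ConeCap

/-! ### Counting the cells -/

/-- The cells on a side of length `a`, over all layers.  The number `e` is what is left over on the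
innermost path, compared with the bound; it pays for inner vertices of the cap. -/
theorem sum_layers_le (a e ℓ : ℕ) (h : e + 2 * a / 3 ≤ a * (a + 2) / 3) :
    e + ∑ t ∈ Finset.range (ℓ + 1), (2 * (a + t) + 3) / 3 ≤
      (ℓ + a) * (ℓ + a + 2) / 3 + (ℓ + 1) := by
  induction ℓ with
  | zero =>
    simp only [zero_add, Finset.sum_range_one, add_zero]
    omega
  | succ ℓ ih =>
    rw [Finset.sum_range_succ]
    have hsq : (ℓ + 1 + a) * (ℓ + 1 + a + 2) = (ℓ + a) * (ℓ + a + 2) + (2 * (ℓ + a) + 3) := by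
      ring
    rw [hsq]
    omega

theorem theorem2 (ℓ : ℕ) :
    (∀ k : ℕ, 3 ≤ k →
      saturationNumber (CNC k ℓ) ≤ ((k * (ℓ * (ℓ + 2) / 3) + k * (ℓ + 1) : ℕ) : ℕ∞)) ∧
    saturationNumber (CN2s ℓ) ≤ ((4 * ((ℓ + 1) * (ℓ + 3) / 3) + 4 * (ℓ + 1) + 1 : ℕ) : ℕ∞) ∧
    saturationNumber (CN2a ℓ) ≤
      ((3 * ((ℓ + 1) * (ℓ + 3) / 3) + ℓ * (ℓ + 2) / 3 + 4 * (ℓ + 1) + 1 : ℕ) : ℕ∞) ∧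
    saturationNumber (CN3s ℓ) ≤ ((3 * ((ℓ + 1) * (ℓ + 3) / 3) + 3 * (ℓ + 1) + 1 : ℕ) : ℕ∞) ∧
    saturationNumber (CN3a ℓ) ≤
      ((2 * ((ℓ + 2) * (ℓ + 4) / 3) + (ℓ + 1) * (ℓ + 3) / 3 + 3 * (ℓ + 1) + 2 : ℕ) : ℕ∞) ∧
    saturationNumber (CN4s ℓ) ≤ ((2 * ((ℓ + 2) * (ℓ + 4) / 3) + 2 * (ℓ + 1) + 3 : ℕ) : ℕ∞) ∧
    saturationNumber (CN4a ℓ) ≤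
      (((ℓ + 3) * (ℓ + 5) / 3 + (ℓ + 2) * (ℓ + 4) / 3 + 2 * (ℓ + 1) + 4 : ℕ) : ℕ∞) ∧
    saturationNumber (CN5a ℓ) ≤ (((ℓ + 5) * (ℓ + 7) / 3 + (ℓ + 1) + 6 : ℕ) : ℕ∞) := by
  have h0 := sum_layers_le 0 0 ℓ (by norm_num)
  have h1 := sum_layers_le 1 1 ℓ (by norm_num)
  have h2 := sum_layers_le 2 1 ℓ (by norm_num)
  have h3 := sum_layers_le 3 3 ℓ (by norm_num)
  have h5 := sum_layers_le 5 8 ℓ (by norm_num)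
  simp only [add_assoc, Nat.reduceAdd, add_zero] at h0 h1 h2 h3 h5
  refine ⟨fun k _ => (ConeCap.saturationNumber_cone_le _ ℓ).trans (Nat.cast_le.2 ?_), ?_⟩
  · simp only [Finset.sum_const, Finset.card_univ, Fintype.card_fin, smul_eq_mul, zero_add,
      ← mul_add] at h0 ⊢
    exact Nat.mul_le_mul_left k h0
  refine ⟨?_, ?_, ?_, ?_, ?_, ?_, ?_⟩ <;>
  · refine (ConeCap.saturationNumber_cone_le _ ℓ).trans (Nat.cast_le.2 ?_)
    simp [Fin.sum_univ_succ] at h0 h1 h2 h3 h5 ⊢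
    omega
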